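/- Let $\Omega$ be a compact Hausdorff space whose set of isolated points is dense in $\Omega$, let $H$ be a complex Hilbert space, and let $M \subseteq B(H)$ be a von Neumann algebra with identity $1$. Let $C(\Omega, M)$ be the unital $C^*$-algebra of norm-continuous functions $\Omega \to M$ with pointwise operations and the supremum norm. For a unital $C^*$-algebra $A$ with closed unit ball $A_1$, call $x \in A_1$ a $C^*$-extreme point of $A_1$ if, whenever $x = \sum_{i=1}^k t_i^* x_i t_i$ with $x_1, \dots, x_k \in A_1$ and $t_1, \dots, t_k \in A$ invertible satisfying $\sum_{i=1}^k t_i^* t_i = 1$, there exist unitaries $u_1, \dots, u_k \in A$ such that $x_i = u_i^* x u_i$ for $i = 1, \dots, k$. If $f$ is a $C^*$-extreme point of $C(\Omega, M)_1$, then $f(\omega)$ is a $C^*$-extreme point of $M_1$ for every $\omega \in \Omega$. -/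

import Mathlib

/-- A von Neumann algebra on `H` is norm closed in the bounded operators. -/
theorem VonNeumannAlgebra.isClosed_toStarSubalgebra {H : Type*} [NormedAddCommGroup H]
    [InnerProductSpace ℂ H] [CompleteSpace H] (M : VonNeumannAlgebra H) :
    IsClosed (M.toStarSubalgebra : Set (H →L[ℂ] H)) := by
  rw [M.coe_toStarSubalgebra, ← M.centralizer_centralizer]
  exact Set.isClosed_centralizer _

/-- A von Neumann algebra on `H` is closed under complex scalar multiplication. -/
instance VonNeumannAlgebra.instSMulMemClass {H : Type*} [NormedAddCommGroup H]
    [InnerProductSpace ℂ H] [CompleteSpace H] :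
    SMulMemClass (VonNeumannAlgebra H) ℂ (H →L[ℂ] H) where
  smul_mem {M} c _ hx := M.toStarSubalgebra.smul_mem hx c

/-- A von Neumann algebra on `H`, with the operations and the operator norm inherited from the
bounded operators on `H`, is a unital C⋆-algebra. -/
noncomputable instance VonNeumannAlgebra.instCStarAlgebra {H : Type*} [NormedAddCommGroup H]
    [InnerProductSpace ℂ H] [CompleteSpace H] (M : VonNeumannAlgebra H) : CStarAlgebra M :=
  StarSubalgebra.cstarAlgebra M (h_closed := M.isClosed_toStarSubalgebra)

/-- `x` is a C⋆-extreme point of the closed unit ball of the unital C⋆-algebra `A`: it lies in the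
ball, and whenever `x = ∑ i, (t i)⋆ * y i * t i` with all `y i` in the closed unit ball, all `t i`
invertible in `A` and `∑ i, (t i)⋆ * t i = 1`, each `y i` is unitarily equivalent to `x` in `A`. -/
def IsCStarExtremePoint {A : Type*} [CStarAlgebra A] (x : A) : Prop :=
  ‖x‖ ≤ 1 ∧
    ∀ (k : ℕ) (y t : Fin k → A),
      (∀ i, ‖y i‖ ≤ 1) → (∀ i, IsUnit (t i)) → ∑ i, star (t i) * t i = 1 →
      x = ∑ i, star (t i) * y i * t i →
      ∀ i, ∃ u ∈ unitary A, y i = star u * x * u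

/-! In a von Neumann algebra `M` the C⋆-extreme points of the ball are exactly the partial
isometries `x` with `(1 - x * star x) * m * (1 - star x * x) = 0` for all `m` in `M`. For fixed `m`
these equations are norm closed in `x`. They hold for `f ω` at isolated points, where `f ω` is
C⋆-extreme by a gluing argument, hence everywhere by density and continuity, and the
characterization turns them back into C⋆-extremality.

Necessity uses only midpoints: if `x ± a` lie in the ball, then `x + a` is unitarily equivalent to
`x` (`exists_unitary_add`). With `x = v * a` polar and `a` the real part of a unitary `u`, `x` is
the midpoint of `v * u` and `v * star u`, hence equivalent to a partial isometry. Adding instead a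
contraction from the defect corner shows that each such contraction is a partial isometry, which is
stable under scaling down only if the corner is zero.

For sufficiency, a central projection `z` splits `x` into an isometry (on `1 - z`) and a coisometry
(on `z`). If an isometry `V` equals `∑ i, star (t i) * y i * t i`, then each `y i` is an isometry
similar to `V` through `t i`. Similar isometries in `M` are unitarily equivalent in `M`: by the Wold
decomposition it is enough to match unitary parts and wandering subspaces, and polar decompositions
of the similarity and of its inverse adjoint do so. -/

open Filter Topology

/-! ### Invertible elements, partial isometries and C⋆-convex combinations. -/

/-- If `e` and `f` are projections and the invertible element `b` maps the range of `e` onto the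
range of `f`, then the partial isometry in the polar decomposition of `b * e` has initial
projection `e` and final projection `f`. -/
theorem exists_partialIsometry_of_invertible {A : Type*} [CStarAlgebra A] {e f b b' : A}
    (he : IsStarProjection e) (hf : IsStarProjection f) (hbb' : b * b' = 1) (hb'b : b' * b = 1)
    (hfbe : f * b * e = b * e) (hebf : e * b' * f = b' * f) :
    ∃ c : A, star (b * e * c) * (b * e * c) = e ∧ (b * e * c) * star (b * e * c) = f ∧
      Commute c e ∧ ∀ y, Commute y e → Commute y (e * star b * b * e) → Commute y c := by
  let _ := CStarAlgebra.spectralOrder A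
  have _ := CStarAlgebra.spectralOrderedRing A
  have hee : e * e = e := he.isIdempotentElem
  have hff : f * f = f := hf.isIdempotentElem
  have hes : star e = e := he.isSelfAdjoint
  have hfs : star f = f := hf.isSelfAdjoint
  have hbb's : star b * star b' = 1 := by rw [← star_mul, hb'b, star_one]
  have hfbes : e * star b * f = e * star b := by
    simpa [mul_assoc, hes, hfs] using congrArg star hfbe
  -- Adding `1 - e` makes the square of `|b * e|` invertible in all of `A`, so no corner algebra is
  -- needed; `c` will be `g` to the power `-1/2`.
  set g : A := e * star b * b * e + (1 - e) with hg
  have hg0 : 0 ≤ g := by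
    refine add_nonneg ?_ he.one_sub.nonneg
    have := star_mul_self_nonneg (b * e)
    simpa [mul_assoc, hes] using this
  have hgs : star g = g := (IsSelfAdjoint.of_nonneg hg0)
  have hge : g * e = e * star b * b * e := by
    rw [hg, add_mul, sub_mul, mul_assoc _ e e, hee, one_mul, sub_self, add_zero]
  obtain ⟨k, hk⟩ : ∃ k, g * k = 1 := by
    refine ⟨e * b' * f * star b' * e + (1 - e), ?_⟩
    have h1 : e * star b * b * e * (e * b' * f * star b' * e) = e := by
      calc _ = e * star b * b * (e * e) * b' * f * star b' * e := by simp only [mul_assoc]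
        _ = e * star b * b * (e * b' * f) * star b' * e := by rw [hee]; simp only [mul_assoc]
        _ = e * star b * (b * b') * f * star b' * e := by rw [hebf]; simp only [mul_assoc]
        _ = (e * star b * f) * star b' * e := by rw [hbb', mul_one]
        _ = e := by rw [hfbes, mul_assoc e, hbb's, mul_one, hee]
    have e1 : e * (1 - e) = 0 := by rw [mul_sub, mul_one, hee, sub_self]
    have e2 : (1 - e) * e = 0 := by rw [sub_mul, one_mul, hee, sub_self]
    rw [hg]
    linear_combination (norm := noncomm_ring)
      h1 + e * star b * b * e1 + e2 * (b' * f * star b' * e - 1)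
  have hgu : IsUnit g := by
    have hk' : star k * g = 1 := by simpa [hgs] using congrArg star hk
    exact ⟨⟨g, k, hk, left_inv_eq_right_inv hk' hk ▸ hk'⟩, rfl⟩
  obtain ⟨⟨r, c, hrc, hcr⟩, hr : r = CFC.sqrt g⟩ := (CFC.isUnit_sqrt_iff g).2 hgu
  have hrr : r * r = g := by rw [hr, CFC.sqrt_mul_sqrt_self g]
  have hrs : star r = r := by rw [hr]; exact IsSelfAdjoint.of_nonneg (CFC.sqrt_nonneg g)
  have hcs : star c = c := by
    refine left_inv_eq_right_inv (a := star r) ?_ (by rw [hrs, hrc])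
    rw [← star_mul, hrc, star_one]
  have hcomm : ∀ y, Commute y e → Commute y (e * star b * b * e) → Commute y c := by
    intro y h1 h2
    have h3 : Commute y r := by
      rw [hr, CFC.sqrt_eq_cfc]
      refine (Commute.cfc_nnreal ?_ _).symm
      exact (h2.add_right ((Commute.one_right y).sub_right h1)).symm
    exact Commute.units_inv_right (u := ⟨r, c, hrc, hcr⟩) h3
  have hec : Commute e c := by
    refine hcomm e (Commute.refl e) ?_
    rw [commute_iff_eq, mul_assoc _ e e, hee]
    simp only [← mul_assoc, hee]
  have hre : r * e = e * r := by
    have h4 : Commute e r := Commute.units_inv_right_iff (u := ⟨r, c, hrc, hcr⟩).1 hec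
    exact h4.eq.symm
  have hww : star (b * e * c) * (b * e * c) = e := by
    calc _ = c * (e * star b * b * e) * c := by simp only [star_mul, hes, hcs, mul_assoc]
      _ = (c * r) * (r * e) * c := by rw [← hge, ← hrr]; simp only [mul_assoc]
      _ = e := by rw [hcr, one_mul, hre, mul_assoc, hrc, mul_one]
  refine ⟨c, hww, ?_, hec.symm, hcomm⟩
  set w := b * e * c with hw
  have h5 : f * w = w := by rw [hw, ← mul_assoc, ← mul_assoc, hfbe]
  -- This puts `f` in the right ideal `w * A`, on which `w * star w` acts as the identity.
  have h6 : f = w * r * b' * f := by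
    have : w * r * b' * f = b * (e * b' * f) := by
      rw [hw]
      calc _ = b * e * (c * r) * b' * f := by simp only [mul_assoc]
        _ = _ := by rw [hcr, mul_one]; simp only [mul_assoc]
    rw [this, hebf, ← mul_assoc, hbb', one_mul]
  have h7 : w * star w * f = f := by
    have h8 : w * e = w := by rw [hw, mul_assoc _ c e, ← hec.eq, ← mul_assoc, mul_assoc b e e, hee]
    calc w * star w * f = w * (star w * w) * r * b' * f := by
          conv_lhs => rw [h6]
          simp only [mul_assoc]
      _ = w * r * b' * f := by rw [hww, h8]
      _ = f := h6.symm
  have h9 : w * star w * f = w * star w := by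
    have : star w * f = star w := by simpa [hfs] using congrArg star h5
    rw [mul_assoc, this]
  rw [← h9, h7]

/-- An isometry `V` in a unital C⋆-algebra which is a C⋆-convex combination of contractions `y i`
with coefficients `t i` is intertwined with the isometry `y i` by `t i`. -/
theorem isometry_of_cstarConvexCombination {A : Type*} [CStarAlgebra A] {ι : Type*} [Fintype ι]
    {V : A} {y t : ι → A} (hV : star V * V = 1) (hy : ∀ i, ‖y i‖ ≤ 1) (ht : ∀ i, IsUnit (t i))
    (hsum : ∑ i, star (t i) * t i = 1) (hVsum : V = ∑ i, star (t i) * y i * t i) (i : ι) :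
    star (y i) * y i = 1 ∧ y i * t i = t i * V := by
  let _ := CStarAlgebra.spectralOrder A
  have _ := CStarAlgebra.spectralOrderedRing A
  have h1 : ∀ i, 0 ≤ star (t i) * (1 - star (y i) * y i) * t i := by
    intro i
    refine star_left_conjugate_nonneg ?_ _
    rw [sub_nonneg, ← CStarAlgebra.norm_le_one_iff_of_nonneg _ (star_mul_self_nonneg _),
      CStarRing.norm_star_mul_self]
    exact mul_le_one₀ (hy i) (norm_nonneg _) (hy i)
  have h2 : ∀ i, 0 ≤ star (y i * t i - t i * V) * (y i * t i - t i * V) :=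
    fun i => star_mul_self_nonneg _
  have hVs : star V = ∑ i, star (t i) * star (y i) * t i := by
    conv_lhs => rw [hVsum]
    simp [mul_assoc]
  -- The sum expands to `1 - star V * V - star V * V + star V * V = 0`, so each of its positive
  -- terms vanishes.
  have h3 : ∑ i, (star (t i) * (1 - star (y i) * y i) * t i
      + star (y i * t i - t i * V) * (y i * t i - t i * V)) = 0 := by
    have : ∀ i, star (t i) * (1 - star (y i) * y i) * t i
      + star (y i * t i - t i * V) * (y i * t i - t i * V)
      = star (t i) * t i - (star (t i) * star (y i) * t i) * V - star V * (star (t i) * y i * t i)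
        + star V * (star (t i) * t i) * V := by
      intro i
      simp only [star_sub, star_mul]
      noncomm_ring
    simp only [this, Finset.sum_add_distrib, Finset.sum_sub_distrib, ← Finset.sum_mul,
      ← Finset.mul_sum, ← hVs, ← hVsum, hsum, hV, mul_one]
    simp
  have h4 := (Finset.sum_eq_zero_iff_of_nonneg fun i _ => add_nonneg (h1 i) (h2 i)).1 h3 i
    (Finset.mem_univ i)
  rw [add_eq_zero_iff_of_nonneg (h1 i) (h2 i)] at h4
  constructor
  · have h5 := h4.1
    rw [(ht i).mul_left_eq_zero, (ht i).star.mul_right_eq_zero, sub_eq_zero] at h5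
    exact h5.symm
  · exact sub_eq_zero.1 ((CStarRing.star_mul_self_eq_zero_iff _).1 h4.2)

/-! ### Midpoints and the defect corner. -/

/-- A C⋆-extreme point of the unit ball is unitarily equivalent to the end points of every segment
in the ball with midpoint `x`. -/
theorem IsCStarExtremePoint.exists_unitary_add {A : Type*} [CStarAlgebra A] {x a : A}
    (hx : IsCStarExtremePoint x) (h₁ : ‖x + a‖ ≤ 1) (h₂ : ‖x - a‖ ≤ 1) :
    ∃ u ∈ unitary A, x + a = star u * x * u := by
  have hr : ((√2⁻¹ : ℝ) : ℂ) * ((√2⁻¹ : ℝ) : ℂ) = 2⁻¹ := by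
    rw [← Complex.ofReal_mul, Real.mul_self_sqrt (by norm_num)]; norm_num
  set r : ℂ := ((√2⁻¹ : ℝ) : ℂ) with hrdef
  have hrs : star r = r := by simp [hrdef]
  have hr0 : r ≠ 0 := fun h => by simp [h] at hr
  have key := hx.2 2 ![x + a, x - a] (fun _ => r • (1 : A)) ?_ ?_ ?_ ?_ 0
  · simpa using key
  · intro i; fin_cases i <;> simpa
  · intro i; exact (isUnit_one (M := A)).smul (Units.mk0 r hr0)
  · simp only [star_smul, star_one, hrs, smul_mul_smul_comm, mul_one, hr, Finset.sum_const,
      Finset.card_univ, Fintype.card_fin]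
    module
  · simp only [star_smul, star_one, hrs, Fin.sum_univ_two, smul_mul_assoc, one_mul, mul_smul_comm,
      mul_one, smul_smul, hr, Matrix.cons_val_zero, Matrix.cons_val_one]
    module

/-- If a C⋆-extreme point `x` of the unit ball is a partial isometry, then
`(1 - x * star x) * m * (1 - star x * x) = 0` for all `m`. -/
theorem IsCStarExtremePoint.defect_mul_defect {A : Type*} [CStarAlgebra A] {x : A}
    (hx : IsCStarExtremePoint x) (hpi : x * star x * x = x) (m : A) :
    (1 - x * star x) * m * (1 - star x * x) = 0 := by
  let _ := CStarAlgebra.spectralOrder A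
  have _ := CStarAlgebra.spectralOrderedRing A
  have hpis : star x * x * star x = star x := by simpa [mul_assoc] using congrArg star hpi
  have hg : IsStarProjection (1 - star x * x) :=
    IsStarProjection.one_sub ⟨by rw [IsIdempotentElem, ← mul_assoc, hpis],
      IsSelfAdjoint.star_mul_self x⟩
  -- contractions in the corner have a projection as absolute value
  have key : ∀ a : A, ‖a‖ ≤ 1 → star x * a = 0 → a * (1 - star x * x) = a →
      (star a * a) * (star a * a) = star a * a := by
    intro a ha hxa hag
    have hax : star a * x = 0 := by simpa using congrArg star hxa
    have hxa' : a * star x = 0 := by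
      have : a * star x = a * (1 - star x * x) * star x := by rw [hag]
      rw [this, mul_assoc, sub_mul, hpis, one_mul, sub_self, mul_zero]
    have hxa's : x * star a = 0 := by simpa using congrArg star hxa'
    have hle : star a * a ≤ 1 - star x * x := by
      have h1 : star a * a ≤ 1 := by
        rw [← CStarAlgebra.norm_le_one_iff_of_nonneg _ (star_mul_self_nonneg _),
          CStarRing.norm_star_mul_self]
        exact mul_le_one₀ ha (norm_nonneg _) ha
      have h2 := star_left_conjugate_le_conjugate h1 (1 - star x * x)
      have h3 : star (1 - star x * x) * (star a * a) * (1 - star x * x)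
        = star (a * (1 - star x * x)) * (a * (1 - star x * x)) := by
        simp only [star_mul, mul_assoc]
      rw [h3, hag, mul_one, hg.isSelfAdjoint.star_eq, hg.isIdempotentElem.eq] at h2
      exact h2
    have hnorm : ∀ b : A, star b * b = star x * x + star a * a → ‖b‖ ≤ 1 := by
      intro b hb
      have : ‖star b * b‖ ≤ 1 := by
        rw [CStarAlgebra.norm_le_one_iff_of_nonneg _ (star_mul_self_nonneg _), hb]
        calc star x * x + star a * a ≤ star x * x + (1 - star x * x) := by gcongr
          _ = 1 := by abel
      rw [CStarRing.norm_star_mul_self] at this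
      nlinarith [norm_nonneg b]
    obtain ⟨u, hu, hxu⟩ := hx.exists_unitary_add (a := a)
      (hnorm _ (by rw [star_add, add_mul, mul_add, mul_add, hxa, hax]; abel))
      (hnorm _ (by rw [star_sub, sub_mul, mul_sub, mul_sub, hxa, hax]; abel))
    have huu : u * star u = 1 := Unitary.mul_star_self_of_mem hu
    -- Being a partial isometry passes from `x` to its unitary conjugate `x + a`; orthogonality then
    -- isolates the same identity for `a`.
    have hpu : (x + a) * star (x + a) * (x + a) = x + a := by
      rw [hxu]
      calc _ = star u * x * (u * star u) * star x * (u * star u) * x * u := by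
            simp only [star_mul, star_star, mul_assoc]
        _ = star u * (x * star x * x) * u := by rw [huu]; simp only [mul_assoc, one_mul]
        _ = _ := by rw [hpi]
    have haa : a * star a * a = a := by
      have : (x + a) * star (x + a) * (x + a) = x * star x * x + a * star a * a
        + a * star x * (x + a) + x * star a * (x + a) + x * (star x * a) + a * (star a * x) := by
        rw [star_add]; noncomm_ring
      rw [this, hpi, hxa', hxa's, hxa, hax] at hpu
      simpa using hpu
    rw [mul_assoc, ← mul_assoc a, haa]
  set a := (1 - x * star x) * m * (1 - star x * x) with ha
  have hxa : star x * a = 0 := by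
    have : star x * (1 - x * star x) = 0 := by
      rw [mul_sub, mul_one, ← mul_assoc, hpis, sub_self]
    rw [ha, ← mul_assoc, ← mul_assoc, this, zero_mul, zero_mul]
  have hag : a * (1 - star x * x) = a := by rw [ha, mul_assoc, hg.isIdempotentElem.eq]
  by_contra ha0
  have hn : 0 < ‖a‖ := norm_pos_iff.2 ha0
  -- `key` applies to every small multiple of `a`. Comparing `s = ‖a‖⁻¹` with half of it leaves the
  -- factor `1/4 - 1/16 = 3/16` times `star a * a`.
  have hs : ∀ s : ℝ, 0 ≤ s → s * ‖a‖ ≤ 1 →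
      (s ^ 4) • ((star a * a) * (star a * a)) = (s ^ 2) • (star a * a) := by
    intro s hs0 hs1
    have := key ((s : ℂ) • a) (by rw [norm_smul]; simpa [abs_of_nonneg hs0] using hs1)
      (by rw [mul_smul_comm, hxa, smul_zero]) (by rw [smul_mul_assoc, hag])
    simp only [star_smul, smul_mul_smul_comm] at this
    simp only [Complex.star_def, Complex.conj_ofReal, ← Complex.ofReal_mul, Complex.coe_smul]
      at this
    convert this using 2 <;> ring
  have e1 := hs (‖a‖⁻¹) (by positivity) (by rw [inv_mul_cancel₀ hn.ne'])
  have e2 := hs (‖a‖⁻¹ / 2) (by positivity) (by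
    rw [div_mul_eq_mul_div, inv_mul_cancel₀ hn.ne']; norm_num)
  have e3 : ((‖a‖⁻¹) ^ 2 * (3 / 16)) • (star a * a) = 0 := by
    have : (‖a‖⁻¹ / 2) ^ 4 = (1 / 16) * ‖a‖⁻¹ ^ 4 := by ring
    rw [this, mul_smul, e1, smul_smul, ← sub_eq_zero, ← sub_smul] at e2
    rw [← neg_eq_zero, ← neg_smul, ← e2]
    congr 1; ring
  rw [smul_eq_zero] at e3
  rcases e3 with h | h
  · exact absurd h (by positivity)
  · exact ha0 ((CStarRing.star_mul_self_eq_zero_iff _).1 h)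

/-! ### Algebra of the Wold decomposition. -/

/-- The approximants of the unitary intertwining two isometries `V` and `W`: on the first `n`
wandering subspaces they act by translates of `w`, on the remainder by `s`. -/
def woldApprox {A : Type*} [Ring A] [StarRing A] (V W s w : A) : ℕ → A
  | 0 => s
  | n + 1 => w + W * woldApprox V W s w n * star V

/-- Exchanging `V` and `W` amounts to taking adjoints, so a limit is unitary once the isometry
statement is known for both orders. -/
theorem star_woldApprox {A : Type*} [Ring A] [StarRing A] (V W s w : A) (n : ℕ) :
    star (woldApprox V W s w n) = woldApprox W V (star s) (star w) n := by
  induction n with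
  | zero => rfl
  | succ n ih => simp [woldApprox, ih, mul_assoc]

theorem pow_mul_star_pow_succ {A : Type*} [Ring A] [StarRing A] (V : A) (n : ℕ) :
    V ^ (n + 1) * star V ^ (n + 1) = V * (V ^ n * star V ^ n) * star V := by
  rw [pow_succ', pow_succ]
  simp only [mul_assoc]

theorem pow_mul_star_pow_add_mul {A : Type*} [Ring A] [StarRing A] {V : A}
    (hV : star V * V = 1) (n k : ℕ) :
    (V ^ (n + k) * star V ^ (n + k)) * (V ^ n * star V ^ n) = V ^ (n + k) * star V ^ (n + k) := by
  induction n with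
  | zero => simp
  | succ n ih =>
    rw [add_right_comm, pow_mul_star_pow_succ, pow_mul_star_pow_succ]
    calc _ = V * ((V ^ (n + k) * star V ^ (n + k)) * (star V * V) * (V ^ n * star V ^ n)) * star V
          := by simp only [mul_assoc]
      _ = _ := by rw [hV, mul_one, ih]

theorem star_pow_mul_star_pow {A : Type*} [Ring A] [StarRing A] (V : A) (n : ℕ) :
    star (V ^ n * star V ^ n) = V ^ n * star V ^ n := by
  simp

/-- If `s` intertwines `V` and `W` and its initial projection reduces `V`, then `star s`
intertwines `W` and `V`. -/
theorem star_mul_eq_mul_star_of_intertwine {A : Type*} [CStarAlgebra A] {V W s p : A}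
    (hW : star W * W = 1) (hs : star s * s = p)
    (hpp : p * p = p) (hps : star p = p) (hVp : V * p * star V = p) (hsV : s * V = W * s) :
    star s * W = V * star s := by
  have hsp : s * p = s := by
    refine (sub_eq_zero.1 ?_).symm
    rw [← CStarRing.star_mul_self_eq_zero_iff]
    have : star (s - s * p) * (s - s * p)
        = star s * s - star s * s * p - p * (star s * s) + p * (star s * s) * p := by
      rw [star_sub, star_mul, hps]; noncomm_ring
    rw [this, hs, hpp, hpp]
    abel
  have h : s * star V = star W * s := by
    calc s * star V = (star W * W) * (s * p) * star V := by rw [hW, one_mul, hsp]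
      _ = star W * (W * s) * p * star V := by simp only [mul_assoc]
      _ = star W * s * (V * p * star V) := by rw [← hsV]; simp only [mul_assoc]
      _ = star W * s := by rw [hVp, mul_assoc, hsp]
  have := congrArg star h
  simpa using this.symm

/-- The range of `w` is orthogonal to those of `W` and `s`, so the cross terms vanish. Since the
result does not depend on `k`, `star (X - Y) * (X - Y)` for two approximants is a difference of
range projections of powers of `V`, which gives strong convergence. -/
theorem star_woldApprox_mul_woldApprox {A : Type*} [CStarAlgebra A] {V W s w p : A}
    (hW : star W * W = 1) (hs : star s * s = p)
    (hpp : p * p = p) (hps : star p = p)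
    (hVp : V * p * star V = p) (hsV : s * V = W * s) (hw : star w * w = 1 - V * star V)
    (hw' : w * star w = 1 - W * star W) (m k : ℕ) :
    star (woldApprox V W s w m) * woldApprox V W s w (m + k)
      = 1 - V ^ m * star V ^ m + p := by
  have hsW := star_mul_eq_mul_star_of_intertwine hW hs hpp hps hVp hsV
  have hWw : star W * w = 0 := by
    rw [← CStarRing.mul_star_self_eq_zero_iff]
    calc star W * w * star (star W * w) = star W * (w * star w) * W := by
          simp only [star_mul, star_star, mul_assoc]
      _ = star W * W - (star W * W) * (star W * W) := by rw [hw']; noncomm_ring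
      _ = 0 := by rw [hW]; simp
  have hwW : star w * W = 0 := by simpa using congrArg star hWw
  have hsw : star s * w = 0 := by
    rw [← CStarRing.mul_star_self_eq_zero_iff]
    calc star s * w * star (star s * w) = star s * (w * star w) * s := by
          simp only [star_mul, star_star, mul_assoc]
      _ = star s * s - (star s * W) * star (star s * W) := by
          rw [hw', star_mul, star_star]; noncomm_ring
      _ = star s * s - V * (star s * s) * star V := by
          rw [hsW, star_mul, star_star]; simp only [mul_assoc]
      _ = 0 := by rw [hs, hVp, sub_self]
  induction m with
  | zero =>
    suffices h : ∀ k, star s * woldApprox V W s w k = p by simpa [woldApprox] using h k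
    intro k
    induction k with
    | zero => exact hs
    | succ k ih =>
      calc star s * (w + W * woldApprox V W s w k * star V)
          = star s * w + (star s * W) * woldApprox V W s w k * star V := by noncomm_ring
        _ = p := by rw [hsw, zero_add, hsW, mul_assoc V, ih, hVp]
  | succ m ih =>
    rw [add_right_comm, pow_mul_star_pow_succ]
    simp only [woldApprox]
    set X := woldApprox V W s w m
    set Y := woldApprox V W s w (m + k)
    calc star (w + W * X * star V) * (w + W * Y * star V)
        = star w * w + (star w * W) * Y * star V + V * star X * (star W * w)
          + V * star X * (star W * W) * Y * star V := by
            simp only [star_add, star_mul, star_star]; noncomm_ring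
      _ = 1 - V * star V + V * (star X * Y) * star V := by
            rw [hw, hwW, hWw, hW]; noncomm_ring
      _ = 1 - V * (V ^ m * star V ^ m) * star V + V * p * star V := by
            rw [ih]; noncomm_ring
      _ = _ := by rw [hVp]

theorem cauchySeq_of_sq_dist_le {E : Type*} [NormedAddCommGroup E] {u : ℕ → E} {a : ℕ → ℝ}
    (ha : CauchySeq a) (h : ∀ m k, ‖u (m + k) - u m‖ ^ 2 ≤ |a (m + k) - a m|) : CauchySeq u := by
  rw [Metric.cauchySeq_iff'] at ha ⊢
  intro ε hε
  obtain ⟨N, hN⟩ := ha (ε ^ 2) (by positivity)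
  refine ⟨N, fun n hn => ?_⟩
  obtain ⟨k, rfl⟩ := Nat.exists_eq_add_of_le hn
  have h1 := hN (N + k) hn
  rw [Real.dist_eq] at h1
  rw [dist_eq_norm]
  exact lt_of_pow_lt_pow_left₀ 2 hε.le ((h N k).trans_lt h1)

/-! ### Strong limits: the unitary part and the intertwining isometry. -/

section Hilbert

variable {H : Type*} [NormedAddCommGroup H] [InnerProductSpace ℂ H] [CompleteSpace H]

theorem ContinuousLinearMap.exists_tendsto_of_cauchySeq (T : ℕ → H →L[ℂ] H)
    (hT : ∀ h, CauchySeq fun n => T n h) :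
    ∃ S : H →L[ℂ] H, ∀ h, Tendsto (fun n => T n h) atTop (𝓝 (S h)) := by
  choose f hf using fun h => cauchySeq_tendsto_of_complete (hT h)
  exact ⟨continuousLinearMapOfTendsto T (tendsto_pi_nhds.2 hf), hf⟩

theorem VonNeumannAlgebra.mem_of_commute (M : VonNeumannAlgebra H) {x : H →L[ℂ] H}
    (h : ∀ c ∈ M.commutant, ∀ ξ, c (x ξ) = x (c ξ)) : x ∈ M := by
  rw [← M.commutant_commutant, VonNeumannAlgebra.mem_commutant_iff]
  exact fun c hc => ContinuousLinearMap.ext (h c hc)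

/-- By the double commutant theorem membership is a commutation condition, and this survives strong
limits. -/
theorem VonNeumannAlgebra.mem_of_tendsto (M : VonNeumannAlgebra H) {T : ℕ → H →L[ℂ] H}
    {S : H →L[ℂ] H} (hT : ∀ n, T n ∈ M)
    (hS : ∀ h, Tendsto (fun n => T n h) atTop (𝓝 (S h))) : S ∈ M := by
  refine M.mem_of_commute fun c hc ξ => ?_
  refine tendsto_nhds_unique ((c.continuous.tendsto _).comp (hS ξ)) ((hS (c ξ)).congr fun n => ?_)
  have := VonNeumannAlgebra.mem_commutant_iff.1 hc (T n) (hT n)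
  exact DFunLike.congr_fun this ξ

theorem ContinuousLinearMap.star_eq_of_tendsto {T : ℕ → H →L[ℂ] H} {S S' : H →L[ℂ] H}
    (hS : ∀ h, Tendsto (fun n => T n h) atTop (𝓝 (S h)))
    (hS' : ∀ h, Tendsto (fun n => star (T n) h) atTop (𝓝 (S' h))) : star S = S' := by
  refine (ContinuousLinearMap.eq_adjoint_iff S' S).2 (fun x y => ?_) |>.symm
  refine tendsto_nhds_unique ((hS' x).inner tendsto_const_nhds)
    (((tendsto_const_nhds (x := x)).inner (hS y)).congr fun n => ?_)
  exact (ContinuousLinearMap.adjoint_inner_left _ _ _).symm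

theorem ContinuousLinearMap.norm_sq_eq_re_inner_star_mul (X : H →L[ℂ] H) (h : H) :
    ‖X h‖ ^ 2 = (inner ℂ ((star X * X) h) h).re :=
  X.apply_norm_sq_eq_inner_adjoint_left h

/-- The range projections of the powers of an isometry converge strongly to a projection reducing
the isometry, on the range of which the isometry is unitary. -/
theorem exists_unitaryPart_projection {V : H →L[ℂ] H} (hV : star V * V = 1) :
    ∃ p : H →L[ℂ] H, (∀ h, Tendsto (fun n => (V ^ n * star V ^ n) h) atTop (𝓝 (p h))) ∧
      IsStarProjection p ∧ p * V = V * p ∧ V * star V * p = p ∧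
      ∀ n, V ^ n * star V ^ n * p = p := by
  set P : ℕ → H →L[ℂ] H := fun n => V ^ n * star V ^ n with hP
  have hPP : ∀ n k, P (n + k) * P n = P (n + k) := pow_mul_star_pow_add_mul hV
  have hPs : ∀ n, star (P n) = P n := star_pow_mul_star_pow V
  have hPP' : ∀ n k, P n * P (n + k) = P (n + k) := fun n k => by
    simpa [hPs] using congrArg star (hPP n k)
  have hsq : ∀ h m k, ‖P (m + k) h - P m h‖ ^ 2
      = (inner ℂ (P m h) h).re - (inner ℂ (P (m + k) h) h).re := by
    intro h m k
    rw [← sub_apply, ContinuousLinearMap.norm_sq_eq_re_inner_star_mul,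
      star_sub, hPs, hPs, sub_mul, mul_sub, mul_sub, hPP, hPP']
    have h0 := hPP m 0
    have h1 := hPP (m + k) 0
    rw [add_zero] at h0 h1
    rw [h0, h1]
    simp
  have hpos : ∀ h n, (inner ℂ (P n h) h).re = ‖P n h‖ ^ 2 := by
    intro h n
    have h0 := hPP n 0
    rw [add_zero] at h0
    rw [ContinuousLinearMap.norm_sq_eq_re_inner_star_mul, hPs, h0]
  obtain ⟨p, hp⟩ := ContinuousLinearMap.exists_tendsto_of_cauchySeq P fun h => by
    -- The range projections decrease, so these bounded scalars converge, and by `hsq` they control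
    -- the vectors `P n h`.
    have hanti : Antitone fun n => (inner ℂ (P n h) h).re := by
      intro m n hmn
      obtain ⟨k, rfl⟩ := Nat.exists_eq_add_of_le hmn
      have := hsq h m k
      have h2 := sq_nonneg ‖P (m + k) h - P m h‖
      simp only
      linarith
    have hbdd : BddBelow (Set.range fun n => (inner ℂ (P n h) h).re) :=
      ⟨0, by rintro _ ⟨n, rfl⟩; simp only [hpos]; positivity⟩
    refine cauchySeq_of_sq_dist_le (tendsto_atTop_ciInf hanti hbdd).cauchySeq fun m k => ?_
    rw [hsq, abs_sub_comm]
    exact le_abs_self _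
  have hps : star p = p :=
    ContinuousLinearMap.star_eq_of_tendsto hp (by simpa only [hPs] using hp)
  have hPp : ∀ n, P n * p = p := by
    intro n
    ext h
    refine tendsto_nhds_unique (((P n).continuous.tendsto _).comp (hp h)) ?_
    refine (hp h).congr' ?_
    filter_upwards [eventually_ge_atTop n] with m hm
    obtain ⟨k, rfl⟩ := Nat.exists_eq_add_of_le hm
    exact (DFunLike.congr_fun (hPP' n k) h).symm
  refine ⟨p, hp, ⟨?_, hps⟩, ?_, by simpa [hP] using hPp 1, hPp⟩
  · ext h
    exact tendsto_nhds_unique (hp (p h))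
      (tendsto_const_nhds.congr fun n => (DFunLike.congr_fun (hPp n) h).symm)
  · ext h
    refine tendsto_nhds_unique ((tendsto_add_atTop_iff_nat 1).2 (hp (V h))) ?_
    refine ((V.continuous.tendsto _).comp (hp h)).congr fun n => ?_
    have : P (n + 1) * V = V * P n := by
      simp only [hP]
      rw [pow_mul_star_pow_succ, mul_assoc, hV, mul_one]
    exact (DFunLike.congr_fun this h).symm

theorem exists_isometry_tendsto_woldApprox {V W s w p : H →L[ℂ] H}
    (hW : star W * W = 1) (hp : ∀ h, Tendsto (fun n => (V ^ n * star V ^ n) h) atTop (𝓝 (p h)))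
    (hs : star s * s = p) (hpp : p * p = p) (hps : star p = p)
    (hVp : V * p * star V = p) (hsV : s * V = W * s) (hw : star w * w = 1 - V * star V)
    (hw' : w * star w = 1 - W * star W) :
    ∃ T : H →L[ℂ] H, (∀ h, Tendsto (fun n => woldApprox V W s w n h) atTop (𝓝 (T h))) ∧
      star T * T = 1 := by
  have key := star_woldApprox_mul_woldApprox hW hs hpp hps hVp hsV hw hw'
  set X : ℕ → H →L[ℂ] H := woldApprox V W s w with hX
  set P : ℕ → H →L[ℂ] H := fun n => V ^ n * star V ^ n with hP
  have hPs : ∀ n, star (P n) = P n := star_pow_mul_star_pow V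
  have key' : ∀ m k, star (X (m + k)) * X m = 1 - P m + p := by
    intro m k
    have := congrArg star (key m k)
    simpa [hps] using this
  have key0 : ∀ m, star (X m) * X m = 1 - P m + p := fun m => key m 0
  have hlim : ∀ h, Tendsto (fun n => (inner ℂ (P n h) h).re) atTop (𝓝 (inner ℂ (p h) h).re) :=
    fun h => (Complex.continuous_re.tendsto _).comp ((hp h).inner tendsto_const_nhds)
  obtain ⟨T, hT⟩ := ContinuousLinearMap.exists_tendsto_of_cauchySeq X fun h => by
    refine cauchySeq_of_sq_dist_le (hlim h).cauchySeq fun m k => ?_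
    rw [← sub_apply, ContinuousLinearMap.norm_sq_eq_re_inner_star_mul,
      star_sub, sub_mul, mul_sub, mul_sub, key0, key0, key', key m k]
    refine le_of_eq_of_le ?_ ((le_abs_self _).trans_eq (abs_sub_comm _ _))
    simp [hP]
  refine ⟨T, hT, ?_⟩
  refine T.norm_map_iff_adjoint_comp_self.1 fun h => ?_
  have h1 : Tendsto (fun n => ‖X n h‖ ^ 2) atTop (𝓝 (‖T h‖ ^ 2)) := (hT h).norm.pow 2
  -- No `X n` need be isometric; the defect `p - P n` vanishes in the limit.
  have h2 : Tendsto (fun n => ‖X n h‖ ^ 2) atTop (𝓝 (‖h‖ ^ 2)) := by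
    have h3 : ∀ n, ‖X n h‖ ^ 2 = ‖h‖ ^ 2 - (inner ℂ (P n h) h).re + (inner ℂ (p h) h).re := by
      intro n
      rw [ContinuousLinearMap.norm_sq_eq_re_inner_star_mul, key0]
      simp only [add_apply, sub_apply, inner_sub_left,
        inner_add_left, Complex.add_re, Complex.sub_re, one_apply_eq_self]
      congr 2
      exact (norm_sq_eq_re_inner (𝕜 := ℂ) h).symm
    simp only [h3]
    have := ((tendsto_const_nhds (x := ‖h‖ ^ 2)).sub (hlim h)).add
      (tendsto_const_nhds (x := (inner ℂ (p h) h).re))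
    simpa using this
  exact (pow_left_inj₀ (norm_nonneg _) (norm_nonneg _) two_ne_zero).1 (tendsto_nhds_unique h1 h2)

end Hilbert

/-! ### Similar isometries are unitarily equivalent. -/

section Hilbert

variable {H : Type*} [NormedAddCommGroup H] [InnerProductSpace ℂ H] [CompleteSpace H]

/-- Two isometries with unitarily equivalent unitary parts and equivalent defect projections are
unitarily equivalent. -/
theorem exists_unitary_tendsto_woldApprox {V W s w p q : H →L[ℂ] H}
    (hV : star V * V = 1) (hW : star W * W = 1)
    (hp : ∀ h, Tendsto (fun n => (V ^ n * star V ^ n) h) atTop (𝓝 (p h)))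
    (hq : ∀ h, Tendsto (fun n => (W ^ n * star W ^ n) h) atTop (𝓝 (q h)))
    (hpP : IsStarProjection p) (hqP : IsStarProjection q)
    (hs : star s * s = p) (hs' : s * star s = q)
    (hVp : V * p * star V = p) (hWq : W * q * star W = q) (hsV : s * V = W * s)
    (hw : star w * w = 1 - V * star V) (hw' : w * star w = 1 - W * star W) :
    ∃ T : H →L[ℂ] H, (∀ h, Tendsto (fun n => woldApprox V W s w n h) atTop (𝓝 (T h))) ∧
      T ∈ unitary (H →L[ℂ] H) ∧ T * V = W * T := by
  have hpp : p * p = p := hpP.isIdempotentElem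
  have hqq : q * q = q := hqP.isIdempotentElem
  have hps : star p = p := hpP.isSelfAdjoint
  have hqs : star q = q := hqP.isSelfAdjoint
  obtain ⟨T, hT, hTT⟩ := exists_isometry_tendsto_woldApprox hW hp hs hpp hps hVp hsV hw hw'
  obtain ⟨T', hT', hTT'⟩ := exists_isometry_tendsto_woldApprox (V := W) (W := V) (s := star s)
    (w := star w) hV hq (by rwa [star_star]) hqq hqs hWq
    (star_mul_eq_mul_star_of_intertwine hW hs hpp hps hVp hsV)
    (by rwa [star_star]) (by rwa [star_star])
  have hTs : star T = T' :=
    ContinuousLinearMap.star_eq_of_tendsto hT (by simpa only [star_woldApprox] using hT')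
  have hwV : w * V = 0 := by
    rw [← CStarRing.star_mul_self_eq_zero_iff]
    calc star (w * V) * (w * V) = star V * (star w * w) * V := by
          simp only [star_mul, mul_assoc]
      _ = star V * V - (star V * V) * (star V * V) := by rw [hw]; noncomm_ring
      _ = 0 := by rw [hV]; simp
  refine ⟨T, hT, ⟨hTT, by rwa [← hTs, star_star] at hTT'⟩, ?_⟩
  ext h
  refine tendsto_nhds_unique ((tendsto_add_atTop_iff_nat 1).2 (hT (V h))) ?_
  refine ((W.continuous.tendsto _).comp (hT h)).congr fun n => ?_
  have : woldApprox V W s w (n + 1) * V = W * woldApprox V W s w n := by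
    rw [woldApprox, add_mul, hwV, zero_add, mul_assoc _ (star V), hV, mul_one]
  exact (DFunLike.congr_fun this h).symm

theorem woldApprox_mem (M : VonNeumannAlgebra H) {V W s w : H →L[ℂ] H} (hV : V ∈ M) (hW : W ∈ M)
    (hs : s ∈ M) (hw : w ∈ M) (n : ℕ) : woldApprox V W s w n ∈ M := by
  induction n with
  | zero => exact hs
  | succ n ih => exact add_mem hw (mul_mem (mul_mem hW ih) (star_mem hV))

theorem isStarProjection_one_sub_mul_star {A : Type*} [Ring A] [StarRing A] {V : A}
    (hV : star V * V = 1) : IsStarProjection (1 - V * star V) :=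
  IsStarProjection.one_sub ⟨by
    rw [IsIdempotentElem, mul_assoc, ← mul_assoc (star V), hV, one_mul],
    IsSelfAdjoint.mul_star_self V⟩

/-- An intertwiner of two isometries maps the unitary part of the first into the unitary part of
the second. -/
theorem unitaryPart_mul_intertwiner {V W p q t : H →L[ℂ] H} (hW : star W * W = 1)
    (hq : ∀ h, Tendsto (fun n => (W ^ n * star W ^ n) h) atTop (𝓝 (q h)))
    (hPp : ∀ n, V ^ n * star V ^ n * p = p) (htV : t * V = W * t) : q * t * p = t * p := by
  have htn : ∀ n, t * V ^ n = W ^ n * t := fun n => (SemiconjBy.pow_right htV n : _)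
  have hWn : ∀ n, star W ^ n * W ^ n = 1 := by
    intro n
    induction n with
    | zero => simp
    | succ n ih =>
      rw [pow_succ, pow_succ', mul_assoc, ← mul_assoc (star W), hW, one_mul, ih]
  have key : ∀ n, W ^ n * star W ^ n * (t * p) = t * p := by
    intro n
    have h1 : t * p = W ^ n * (t * star V ^ n * p) := by
      calc t * p = (t * V ^ n) * star V ^ n * p := by
            conv_lhs => rw [← hPp n]
            simp only [mul_assoc]
        _ = _ := by rw [htn]; simp only [mul_assoc]
    rw [h1, mul_assoc, ← mul_assoc (star W ^ n), hWn, one_mul]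
  ext h
  exact tendsto_nhds_unique (hq ((t * p) h))
    (tendsto_const_nhds.congr fun n => (DFunLike.congr_fun (key n) h).symm)

/-- Similar isometries in a von Neumann algebra are unitarily equivalent in it. -/
theorem VonNeumannAlgebra.exists_unitary_of_similar_isometries (M : VonNeumannAlgebra H)
    {V W t : M} (hV : star V * V = 1) (hW : star W * W = 1) (ht : IsUnit t)
    (htV : t * V = W * t) : ∃ u ∈ unitary M, u * V = W * u := by
  obtain ⟨⟨t, t', htt', ht't⟩, rfl⟩ := ht
  simp only at htV
  have htV' : t' * W = V * t' := by
    calc t' * W = t' * (W * t) * t' := by rw [mul_assoc, mul_assoc, htt', mul_one]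
      _ = V * t' := by rw [← htV, ← mul_assoc, ht't, one_mul]
  have hVc : star (V : H →L[ℂ] H) * V = 1 := congrArg Subtype.val hV
  have hWc : star (W : H →L[ℂ] H) * W = 1 := congrArg Subtype.val hW
  obtain ⟨p, hp, hpP, hpV, hVVp, hPp⟩ := exists_unitaryPart_projection hVc
  obtain ⟨q, hq, hqP, hqW, hWWq, hQq⟩ := exists_unitaryPart_projection hWc
  have hpM : p ∈ M := M.mem_of_tendsto
    (fun n => mul_mem (pow_mem V.2 n) (pow_mem (star_mem V.2) n)) hp
  have hqM : q ∈ M := M.mem_of_tendsto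
    (fun n => mul_mem (pow_mem W.2 n) (pow_mem (star_mem W.2) n)) hq
  have hqtp : q * t * p = t * p :=
    unitaryPart_mul_intertwiner hWc hq hPp (congrArg Subtype.val htV)
  have hptq : p * t' * q = t' * q :=
    unitaryPart_mul_intertwiner hVc hp hQq (congrArg Subtype.val htV')
  lift p to M using hpM
  lift q to M using hqM
  have hpP' : IsStarProjection p :=
    ⟨Subtype.ext hpP.isIdempotentElem, Subtype.ext hpP.isSelfAdjoint⟩
  have hqP' : IsStarProjection q :=
    ⟨Subtype.ext hqP.isIdempotentElem, Subtype.ext hqP.isSelfAdjoint⟩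
  have hpV' : p * V = V * p := Subtype.ext hpV
  have hps : star p = p := hpP'.isSelfAdjoint
  have hpp : p * p = p := hpP'.isIdempotentElem
  have hVVp' : V * star V * p = p := Subtype.ext hVVp
  have hpVV' : p * (V * star V) = p := by simpa [hps] using congrArg star hVVp'
  have hpVs : star V * p = p * star V := by simpa [hps] using congrArg star hpV'
  have hVp : (V : H →L[ℂ] H) * p * star (V : H →L[ℂ] H) = p := by
    rw [← hpV, mul_assoc]
    exact congrArg Subtype.val hpVV'
  have hWq : (W : H →L[ℂ] H) * q * star (W : H →L[ℂ] H) = q := by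
    have h1 : (q : H →L[ℂ] H) * (W * star (W : H →L[ℂ] H)) = q := by
      simpa [hqP.isSelfAdjoint.star_eq] using congrArg star hWWq
    rw [← hqW, mul_assoc, h1]
  -- the unitary parts
  obtain ⟨c, hs, hs', hcp, hc⟩ := exists_partialIsometry_of_invertible hpP' hqP' htt' ht't
    (Subtype.ext hqtp) (Subtype.ext hptq)
  have hVtt : star V * (star t * t) * V = star t * t := by
    calc star V * (star t * t) * V = star (t * V) * (t * V) := by simp only [star_mul, mul_assoc]
      _ = star t * (star W * W) * t := by rw [htV]; simp only [star_mul, mul_assoc]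
      _ = _ := by rw [hW, mul_one]
  -- `V` commutes with `p` and with `p * star t * t * p`, hence with `c`; so the polar part `t * p *
  -- c` still intertwines `V` and `W`.
  have hVcomm : Commute V c := by
    refine hc V hpV'.symm ?_
    have h1 : star V * (p * star t * t * p) * V = p * star t * t * p := by
      calc star V * (p * star t * t * p) * V = (star V * p) * star t * t * (p * V) := by
            simp only [mul_assoc]
        _ = p * (star V * (star t * t) * V) * p := by rw [hpVs, hpV']; simp only [mul_assoc]
        _ = _ := by rw [hVtt]; simp only [mul_assoc]
    calc V * (p * star t * t * p) = V * star V * p * star t * t * p * V := by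
          conv_lhs => rw [← h1]
          simp only [mul_assoc]
      _ = p * star t * t * p * V := by rw [hVVp']
  have hsV : t * p * c * V = W * (t * p * c) := by
    calc t * p * c * V = t * (p * V) * c := by rw [mul_assoc, ← hVcomm.eq]; simp only [mul_assoc]
      _ = (t * V) * p * c := by rw [hpV']; simp only [mul_assoc]
      _ = _ := by rw [htV]; simp only [mul_assoc]
  -- the wandering subspaces
  have hVs : star V * star t = star t * star W := by simpa using congrArg star htV
  have hWs : star W * star t' = star t' * star V := by simpa using congrArg star htV'
  -- The wandering subspace of `V` is the kernel of `star V`, which `t` need not carry into that of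
  -- `star W`. The inverse adjoint `star t'` intertwines `star V` and `star W`, so it does.
  obtain ⟨d, hw, hw', -, -⟩ := exists_partialIsometry_of_invertible (b := star t') (b' := star t)
    (isStarProjection_one_sub_mul_star hV) (isStarProjection_one_sub_mul_star hW)
    (by rw [← star_mul, htt', star_one]) (by rw [← star_mul, ht't, star_one])
    (by
      have h1 : star V * (1 - V * star V) = 0 := by
        rw [mul_sub, mul_one, ← mul_assoc, hV, one_mul, sub_self]
      linear_combination (norm := noncomm_ring) -W * hWs * (1 - V * star V) - W * star t' * h1)
    (by
      have h1 : star W * (1 - W * star W) = 0 := by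
        rw [mul_sub, mul_one, ← mul_assoc, hW, one_mul, sub_self]
      linear_combination (norm := noncomm_ring) -V * hVs * (1 - W * star W) - V * star t * h1)
  obtain ⟨T, hT, hTu, hTV⟩ := exists_unitary_tendsto_woldApprox hVc hWc hp hq hpP hqP
    (congrArg Subtype.val hs) (congrArg Subtype.val hs') hVp hWq (congrArg Subtype.val hsV)
    (congrArg Subtype.val hw) (congrArg Subtype.val hw')
  have hTM : T ∈ M := M.mem_of_tendsto
    (woldApprox_mem M V.2 W.2 (t * p * c).2 (star t' * (1 - V * star V) * d).2) hT
  exact ⟨⟨T, hTM⟩, ⟨Subtype.ext hTu.1, Subtype.ext hTu.2⟩, Subtype.ext hTV⟩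

/-- Isometries in a von Neumann algebra are C⋆-extreme points of its unit ball. -/
theorem VonNeumannAlgebra.exists_unitary_of_isometry (M : VonNeumannAlgebra H) {ι : Type*}
    [Fintype ι] {V : M} {y t : ι → M} (hV : star V * V = 1) (hy : ∀ i, ‖y i‖ ≤ 1)
    (ht : ∀ i, IsUnit (t i)) (hsum : ∑ i, star (t i) * t i = 1)
    (hVsum : V = ∑ i, star (t i) * y i * t i) (i : ι) : ∃ u ∈ unitary M, u * V = y i * u := by
  obtain ⟨h1, h2⟩ := isometry_of_cstarConvexCombination hV hy ht hsum hVsum i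
  exact M.exists_unitary_of_similar_isometries hV h1 (ht i) h2.symm

end Hilbert

/-! ### Polar decomposition and central projections. -/

/-- The absolute value `a` of a contraction is the real part of a unitary. -/
theorem exists_abs_add_I_smul_mem_unitary {A : Type*} [CStarAlgebra A] {x : A} (hx : ‖x‖ ≤ 1) :
    ∃ a s : A, star a = a ∧ a * a = star x * x ∧ star s = s ∧
      a + Complex.I • s ∈ unitary A := by
  let _ := CStarAlgebra.spectralOrder A
  have _ := CStarAlgebra.spectralOrderedRing A
  have haa : CFC.sqrt (star x * x) * CFC.sqrt (star x * x) = star x * x :=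
    CFC.sqrt_mul_sqrt_self _ (star_mul_self_nonneg x)
  have has : IsSelfAdjoint (CFC.sqrt (star x * x)) := IsSelfAdjoint.of_nonneg (CFC.sqrt_nonneg _)
  refine ⟨CFC.sqrt (star x * x), _, has, haa, IsSelfAdjoint.of_nonneg (CFC.sqrt_nonneg _),
    has.self_add_I_smul_cfcSqrt_sub_sq_mem_unitary _ ?_⟩
  have h1 : ‖star (CFC.sqrt (star x * x)) * CFC.sqrt (star x * x)‖ = ‖star x * x‖ := by
    rw [has.star_eq, haa]
  rw [CStarRing.norm_star_mul_self, CStarRing.norm_star_mul_self] at h1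
  nlinarith [norm_nonneg (CFC.sqrt (star x * x)), norm_nonneg x]

section Hilbert

variable {H : Type*} [NormedAddCommGroup H] [InnerProductSpace ℂ H] [CompleteSpace H]

theorem ContinuousLinearMap.star_mul_self_eq_starProjection {K : Submodule ℂ H}
    [K.HasOrthogonalProjection] {F : K →L[ℂ] H} {v : H →L[ℂ] H} (hF : ∀ k, ‖F k‖ = ‖k‖)
    (hv : ∀ h, v h = F (K.orthogonalProjectionOnto h)) : star v * v = K.starProjection := by
  ext h
  refine ext_inner_right ℂ fun k => ?_
  have h1 : inner ℂ ((star v * v) h) k = inner ℂ (v h) (v k) :=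
    ContinuousLinearMap.adjoint_inner_left v k (v h)
  have h2 : inner ℂ (F (K.orthogonalProjectionOnto h)) (F (K.orthogonalProjectionOnto k))
      = inner ℂ (K.orthogonalProjectionOnto h) (K.orthogonalProjectionOnto k) :=
    LinearIsometry.inner_map_map ⟨(F : K →ₗ[ℂ] H), hF⟩ _ _
  rw [h1, hv, hv, h2, Submodule.inner_orthogonalProjectionOnto_eq_of_mem_left]
  rfl

/-- Polar decomposition: if `a` is selfadjoint with `a * a = star x * x`, then `x = v * a` for a
partial isometry `v` commuting with every operator that commutes with `a` and `x`. -/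
theorem ContinuousLinearMap.exists_polar {a x : H →L[ℂ] H} (ha : star a = a)
    (hax : a * a = star x * x) :
    ∃ v : H →L[ℂ] H, v * star v * v = v ∧ v * a = x ∧
      ∀ c : H →L[ℂ] H, c * a = a * c → c * x = x * c → c * v = v * c := by
  have hnorm : ∀ h, ‖x h‖ = ‖a h‖ := by
    intro h
    have : ‖x h‖ ^ 2 = ‖a h‖ ^ 2 := by
      rw [norm_sq_eq_re_inner_star_mul, norm_sq_eq_re_inner_star_mul, ha, hax]
    exact (pow_left_inj₀ (norm_nonneg _) (norm_nonneg _) two_ne_zero).1 this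
  let K : Submodule ℂ H := a.range.topologicalClosure
  have : CompleteSpace K := (Submodule.isClosed_topologicalClosure _).completeSpace_coe
  have hmem : ∀ h, a h ∈ K := fun h => Submodule.le_topologicalClosure _ ⟨h, rfl⟩
  -- `F` is the isometric extension of `a h ↦ x h` from the range of `a` to its closure.
  obtain ⟨F, hF, hFn⟩ : ∃ F : K →L[ℂ] H, (∀ h, F ⟨a h, hmem h⟩ = x h) ∧ ∀ k, ‖F k‖ = ‖k‖ := by
    let e : H →ₗ[ℂ] K := (a : H →ₗ[ℂ] H).codRestrict K hmem
    have he : DenseRange e := by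
      intro k
      rw [closure_subtype]
      have h1 : (k : H) ∈ closure (Set.range a) := k.2
      convert h1 using 2
      ext y
      constructor
      · rintro ⟨_, ⟨h, rfl⟩, rfl⟩; exact ⟨h, rfl⟩
      · rintro ⟨h, rfl⟩; exact ⟨e h, ⟨h, rfl⟩, rfl⟩
    have hbd : ∃ C : ℝ, ∀ h, ‖(x : H →ₗ[ℂ] H) h‖ ≤ C * ‖e h‖ :=
      ⟨1, fun h => by rw [one_mul]; exact (hnorm h).le⟩
    have hF : ∀ h, (x : H →ₗ[ℂ] H).extendOfNorm e (e h) = x h := LinearMap.extendOfNorm_eq he hbd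
    refine ⟨(x : H →ₗ[ℂ] H).extendOfNorm e, hF, fun k => ?_⟩
    refine isClosed_property he
      (isClosed_eq (ContinuousLinearMap.continuous _).norm continuous_norm) (fun h => ?_) k
    rw [hF]; exact hnorm h
  obtain ⟨v, hv⟩ : ∃ v : H →L[ℂ] H, ∀ h, v h = F (K.orthogonalProjectionOnto h) :=
    ⟨F ∘L K.orthogonalProjectionOnto, fun h => rfl⟩
  have hva : ∀ h, v (a h) = x h := by
    intro h
    have : K.orthogonalProjectionOnto (a h) = ⟨a h, hmem h⟩ :=
      K.orthogonalProjectionOnto_mem_subspace_eq_self ⟨a h, hmem h⟩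
    rw [hv, this, hF]
  have hvK : ∀ h ∈ Kᗮ, v h = 0 := by
    intro h hh
    rw [hv, Submodule.orthogonalProjectionOnto_eq_zero_iff.2 hh, map_zero]
  have hker : ∀ h, h ∈ Kᗮ ↔ a h = 0 := by
    intro h
    have h1 : adjoint a = a := ha
    rw [Submodule.orthogonal_closure, orthogonal_range, h1]
    rfl
  have hvv := ContinuousLinearMap.star_mul_self_eq_starProjection hFn hv
  refine ⟨v, ?_, ContinuousLinearMap.ext hva, ?_⟩
  · rw [mul_assoc, hvv]
    ext h
    have h1 := hvK _ (K.sub_starProjection_mem_orthogonal h)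
    rw [map_sub, sub_eq_zero] at h1
    exact h1.symm
  · intro c hca hcx
    -- Commutation is checked on `K`, where `v` sends `a h` to `x h`, and on `Kᗮ`, the kernel of
    -- `a`, which `c` preserves and `v` annihilates.
    have hK : K ≤ (c * v - v * c).ker := by
      refine Submodule.topologicalClosure_minimal _ ?_ (c * v - v * c).isClosed_ker
      rintro _ ⟨h, rfl⟩
      have h1 : c (a h) = a (c h) := DFunLike.congr_fun hca h
      have h2 : c (x h) = x (c h) := DFunLike.congr_fun hcx h
      change c (v (a h)) - v (c (a h)) = 0
      rw [h1, hva, hva, h2, sub_self]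
    ext h
    have h1 : c (v (K.starProjection h)) - v (c (K.starProjection h)) = 0 :=
      hK (K.starProjection_apply_mem h)
    have h2 := K.sub_starProjection_mem_orthogonal h
    have h3 : c (h - K.starProjection h) ∈ Kᗮ := by
      have h4 : c (a (h - K.starProjection h)) = a (c (h - K.starProjection h)) :=
        DFunLike.congr_fun hca _
      rw [hker, ← h4, (hker _).1 h2, map_zero]
    have h5 := hvK _ h2
    have h6 := hvK _ h3
    rw [map_sub, sub_eq_zero] at h5
    rw [map_sub, map_sub, sub_eq_zero] at h6
    change c (v h) = v (c h)
    rw [h5, h6]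
    exact sub_eq_zero.1 h1

omit [CompleteSpace H] in
theorem Submodule.map_mem_topologicalClosure_span {S : Set H} {y : H →L[ℂ] H}
    (hy : ∀ ξ ∈ S, y ξ ∈ S) {ξ : H} (hξ : ξ ∈ (Submodule.span ℂ S).topologicalClosure) :
    y ξ ∈ (Submodule.span ℂ S).topologicalClosure := by
  refine map_mem_closure y.continuous hξ fun η hη => ?_
  have : Submodule.span ℂ S ≤ (Submodule.span ℂ S).comap (y : H →ₗ[ℂ] H) :=
    Submodule.span_le.2 fun ζ hζ => Submodule.subset_span (hy ζ hζ)
  exact this hη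

/-- If `e * m * g = 0` for all `m` in a von Neumann algebra, with `g` selfadjoint, then a central
projection separates `e` from `g`. -/
theorem VonNeumannAlgebra.exists_central_projection (M : VonNeumannAlgebra H) {e g : M}
    (hg : star g = g) (h : ∀ m, e * m * g = 0) :
    ∃ z : M, IsStarProjection z ∧ (∀ m, z * m = m * z) ∧ e * z = 0 ∧ g * z = g := by
  -- The closed span of `M g H` is invariant under `M` and its commutant, so its projection is
  -- central; `e` annihilates it by hypothesis.
  set S : Set H := {ξ | ∃ m ∈ M, ∃ η, ξ = m ((g : H →L[ℂ] H) η)} with hS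
  set K : Submodule ℂ H := (Submodule.span ℂ S).topologicalClosure with hK
  have : CompleteSpace K := (Submodule.isClosed_topologicalClosure _).completeSpace_coe
  have hP : IsStarProjection K.starProjection := isStarProjection_starProjection
  have hPM : K.starProjection ∈ M := by
    rw [VonNeumannAlgebra.IsStarProjection.mem_iff hP]
    intro y hy
    rw [Module.End.mem_invtSubmodule]
    simp only [Submodule.range_starProjection]
    intro ξ hξ
    refine Submodule.map_mem_topologicalClosure_span ?_ hξ
    rintro _ ⟨m, hm, η, rfl⟩
    refine ⟨m, hm, y η, ?_⟩
    rw [VonNeumannAlgebra.mem_commutant_iff] at hy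
    have h1 := DFunLike.congr_fun (hy (m * g) (mul_mem hm g.2)) η
    exact h1.symm
  have hPM' : K.starProjection ∈ M.commutant := by
    rw [VonNeumannAlgebra.IsStarProjection.mem_iff hP]
    intro y hy
    rw [VonNeumannAlgebra.commutant_commutant] at hy
    rw [Module.End.mem_invtSubmodule]
    simp only [Submodule.range_starProjection]
    intro ξ hξ
    refine Submodule.map_mem_topologicalClosure_span ?_ hξ
    rintro _ ⟨m, hm, η, rfl⟩
    exact ⟨y * m, mul_mem hy hm, η, rfl⟩
  refine ⟨⟨K.starProjection, hPM⟩, ⟨Subtype.ext hP.isIdempotentElem, Subtype.ext hP.isSelfAdjoint⟩,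
    fun m => Subtype.ext ?_, Subtype.ext ?_, Subtype.ext ?_⟩
  · exact (VonNeumannAlgebra.mem_commutant_iff.1 hPM' m m.2).symm
  · have hle : K ≤ (e : H →L[ℂ] H).ker := by
      refine Submodule.topologicalClosure_minimal _ ?_ (e : H →L[ℂ] H).isClosed_ker
      rw [Submodule.span_le]
      rintro _ ⟨m, hm, η, rfl⟩
      exact DFunLike.congr_fun (congrArg Subtype.val (h ⟨m, hm⟩)) η
    ext ξ
    exact hle (K.starProjection_apply_mem ξ)
  · have hg' : star (g : H →L[ℂ] H) = g := congrArg Subtype.val hg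
    have h1 : K.starProjection * (g : H →L[ℂ] H) = g := by
      ext ξ
      refine Submodule.starProjection_eq_self_iff.2 ?_
      exact Submodule.le_topologicalClosure _ (Submodule.subset_span ⟨1, one_mem M, ξ, rfl⟩)
    have h2 := congrArg star h1
    rw [star_mul, hg', hP.isSelfAdjoint.star_eq] at h2
    exact h2

end Hilbert

theorem norm_mul_one_sub_add_le_one {A : Type*} [CStarAlgebra A] {z a : A}
    (hz : IsStarProjection z) (hzc : ∀ m, z * m = m * z) (ha : ‖a‖ ≤ 1) :
    ‖a * (1 - z) + z‖ ≤ 1 := by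
  let _ := CStarAlgebra.spectralOrder A
  have _ := CStarAlgebra.spectralOrderedRing A
  have hzz : z * z = z := hz.isIdempotentElem
  have hzs : star z = z := hz.isSelfAdjoint
  have h1 : star a * a ≤ 1 := by
    rw [← CStarAlgebra.norm_le_one_iff_of_nonneg _ (star_mul_self_nonneg _),
      CStarRing.norm_star_mul_self]
    exact mul_le_one₀ ha (norm_nonneg _) ha
  have h2 := star_left_conjugate_le_conjugate h1 (1 - z)
  have h3 : star (a * (1 - z) + z) * (a * (1 - z) + z)
      = star (1 - z) * (star a * a) * (1 - z) + z := by
    simp only [star_add, star_mul, star_sub, star_one, hzs]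
    have h4 : (1 - z) * star a * z = 0 := by
      rw [mul_assoc, ← hzc, ← mul_assoc, sub_mul, one_mul, hzz, sub_self, zero_mul]
    have h5 : z * a * (1 - z) = 0 := by
      rw [hzc, mul_assoc, mul_sub, mul_one, hzz, sub_self, mul_zero]
    linear_combination (norm := noncomm_ring) h4 + h5 + hzz
  have h6 : ‖star (a * (1 - z) + z) * (a * (1 - z) + z)‖ ≤ 1 := by
    rw [CStarAlgebra.norm_le_one_iff_of_nonneg _ (star_mul_self_nonneg _), h3]
    rw [mul_one, hz.one_sub.isSelfAdjoint.star_eq, hz.one_sub.isIdempotentElem.eq] at h2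
    rw [hz.one_sub.isSelfAdjoint.star_eq]
    calc _ ≤ (1 - z) + z := by gcongr
      _ = 1 := by abel
  rw [CStarRing.norm_star_mul_self] at h6
  nlinarith [norm_nonneg (a * (1 - z) + z)]

theorem norm_le_one_of_mul_star_mul_self {A : Type*} [CStarAlgebra A] {v : A}
    (hv : v * star v * v = v) : ‖v‖ ≤ 1 := by
  have h : IsStarProjection (star v * v) :=
    ⟨by rw [IsIdempotentElem, mul_assoc, ← mul_assoc v, hv], IsSelfAdjoint.star_mul_self v⟩
  have h1 := h.norm_le
  rw [CStarRing.norm_star_mul_self] at h1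
  nlinarith [norm_nonneg v]

/-- A C⋆-extreme point of the unit ball which has a polar decomposition is a partial isometry. -/
theorem IsCStarExtremePoint.mul_star_mul_self {A : Type*} [CStarAlgebra A] {x a s v : A}
    (hx : IsCStarExtremePoint x) (has : star a = a) (hss : star s = s)
    (hu : a + Complex.I • s ∈ unitary A) (hv : v * star v * v = v) (hva : v * a = x) :
    x * star x * x = x := by
  have hvn := norm_le_one_of_mul_star_mul_self hv
  set u := a + Complex.I • s with hudef
  have hus : star u = a - Complex.I • s := by
    simp [hudef, has, hss, sub_eq_add_neg]
  have hle : ∀ b ∈ unitary A, ‖v * b‖ ≤ 1 := by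
    intro b hb
    rw [CStarRing.norm_mul_mem_unitary _ hb]
    exact hvn
  -- This exhibits `x` as the midpoint of the contractions `v * u` and `v * star u`.
  have h1 : x + v * (Complex.I • s) = v * u := by rw [hudef, mul_add, hva]
  have h2 : x - v * (Complex.I • s) = v * star u := by rw [hus, mul_sub, hva]
  obtain ⟨w, hw, hxw⟩ := hx.exists_unitary_add (a := v * (Complex.I • s))
    (by rw [h1]; exact hle u hu) (by rw [h2]; exact hle _ (Unitary.star_mem hu))
  rw [h1] at hxw
  have huu : u * star u = 1 := Unitary.mul_star_self_of_mem hu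
  have hww : w * star w = 1 := Unitary.mul_star_self_of_mem hw
  have hx' : x = w * v * u * star w := by
    calc x = (w * star w) * x * (w * star w) := by rw [hww, mul_one, one_mul]
      _ = w * (star w * x * w) * star w := by simp only [mul_assoc]
      _ = _ := by rw [← hxw]; simp only [mul_assoc]
  have hww' : star w * w = 1 := Unitary.star_mul_self_of_mem hw
  calc x * star x * x
      = w * v * u * (star w * w) * star u * star v * (star w * w) * v * u * star w := by
        rw [hx']; simp only [star_mul, star_star, mul_assoc]
    _ = w * v * (u * star u) * star v * v * u * star w := by
        rw [hww']; simp only [mul_assoc, one_mul]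
    _ = w * (v * star v * v) * u * star w := by rw [huu]; simp only [mul_assoc, one_mul]
    _ = x := by rw [hv, ← hx']

/-! ### Characterization of the C⋆-extreme points of a von Neumann algebra. -/

section Hilbert

variable {H : Type*} [NormedAddCommGroup H] [InnerProductSpace ℂ H] [CompleteSpace H]

/-- On the summand `1 - z`, `x` is an isometry. Replacing the `z`-parts of `x` and of all `y i` by
`z` gives a global isometry and keeps the convex combination, because `z` is central and `∑ i, star
(t i) * t i = 1`. -/
theorem VonNeumannAlgebra.exists_unitary_mul_one_sub (M : VonNeumannAlgebra H) {ι : Type*}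
    [Fintype ι] {x z : M} {y t : ι → M} (hz : IsStarProjection z) (hzc : ∀ m, z * m = m * z)
    (hxz : (1 - star x * x) * z = 1 - star x * x) (hy : ∀ i, ‖y i‖ ≤ 1)
    (ht : ∀ i, IsUnit (t i)) (hsum : ∑ i, star (t i) * t i = 1)
    (hxsum : x = ∑ i, star (t i) * y i * t i) (i : ι) :
    ∃ u ∈ unitary M, u * x * (1 - z) = y i * u * (1 - z) := by
  have hzz : z * z = z := hz.isIdempotentElem
  have hzs : star z = z := hz.isSelfAdjoint
  have hz0 : z * (1 - z) = 0 := by rw [mul_sub, mul_one, hzz, sub_self]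
  have hz1 : (1 - z) * (1 - z) = 1 - z := hz.one_sub.isIdempotentElem
  have hV : star (x * (1 - z) + z) * (x * (1 - z) + z) = 1 := by
    simp only [star_add, star_mul, star_sub, star_one, hzs]
    have h4 : (1 - z) * star x * z = 0 := by
      rw [mul_assoc, ← hzc, ← mul_assoc, sub_mul, one_mul, hzz, sub_self, zero_mul]
    have h5 : z * x * (1 - z) = 0 := by
      rw [hzc, mul_assoc, hz0, mul_zero]
    have h6 : (1 - z) * (star x * x) * (1 - z) = 1 - z := by
      have h7 : star x * x * (1 - z) = 1 - z := by
        linear_combination (norm := noncomm_ring) hxz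
      rw [mul_assoc, h7, hz1]
    linear_combination (norm := noncomm_ring) h4 + h5 + hzz + h6
  obtain ⟨u, hu, huV⟩ := M.exists_unitary_of_isometry (y := fun i => y i * (1 - z) + z) hV
    (fun i => norm_mul_one_sub_add_le_one hz hzc (hy i)) ht hsum (by
      have : ∀ i, star (t i) * (y i * (1 - z) + z) * t i
          = star (t i) * y i * t i * (1 - z) + star (t i) * t i * z := by
        intro i
        linear_combination (norm := noncomm_ring) -star (t i) * y i * hzc (t i)
          + star (t i) * hzc (t i)
      simp only [this, Finset.sum_add_distrib, ← Finset.sum_mul, hsum, ← hxsum, one_mul]) i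
  refine ⟨u, hu, ?_⟩
  have h8 := congrArg (· * (1 - z)) huV
  have h9 := hzc u
  linear_combination (norm := noncomm_ring) h8 - u * x * hz1 - u * hz0 + y i * u * hz1
    + u * hz0 - y i * h9 * (1 - z) + h9 * (1 - z)

/-- Partial isometries `x` in a von Neumann algebra `M` satisfying
`(1 - x * star x) * M * (1 - star x * x) = 0` are C⋆-extreme points of the unit ball. -/
theorem VonNeumannAlgebra.isCStarExtremePoint_of_defect_mul_defect (M : VonNeumannAlgebra H)
    {x : M} (hpi : x * star x * x = x)
    (hx : ∀ m, (1 - x * star x) * m * (1 - star x * x) = 0) : IsCStarExtremePoint x := by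
  refine ⟨norm_le_one_of_mul_star_mul_self hpi, fun k y t hy ht hsum hxsum i => ?_⟩
  obtain ⟨z, hz, hzc, hez, hgz⟩ := M.exists_central_projection (by simp) hx
  have hzz : z * z = z := hz.isIdempotentElem
  have hzs : star z = z := hz.isSelfAdjoint
  obtain ⟨u, hu, hux⟩ := M.exists_unitary_mul_one_sub hz hzc hgz hy ht hsum hxsum i
  -- On the summand `z` it is `star x` that is isometric, so the same lemma applies to adjoints with
  -- `1 - z` in place of `z`.
  obtain ⟨w, hw, hwx⟩ := M.exists_unitary_mul_one_sub (x := star x) (y := fun i => star (y i))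
    hz.one_sub (fun m => by rw [sub_mul, mul_sub, hzc, one_mul, mul_one])
    (by rw [star_star, mul_sub, hez, mul_one, sub_zero]) (fun i => by rw [norm_star]; exact hy i)
    ht hsum (by conv_lhs => rw [hxsum]
                simp [mul_assoc]) i
  have huu : u * star u = 1 := Unitary.mul_star_self_of_mem hu
  have hww : w * star w = 1 := Unitary.mul_star_self_of_mem hw
  have huu' : star u * u = 1 := Unitary.star_mul_self_of_mem hu
  have hww' : star w * w = 1 := Unitary.star_mul_self_of_mem hw
  rw [sub_sub_cancel] at hwx
  have hwx' : w * x * z = y i * w * z := by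
    have h1 : z * (x * star w) = z * (star w * y i) := by
      simpa [hzs, mul_assoc] using congrArg star hwx
    calc w * x * z = w * (z * (x * star w)) * w := by
          rw [hzc]
          calc w * x * z = w * x * z * (star w * w) := by rw [hww', mul_one]
            _ = w * x * (z * star w) * w := by simp only [mul_assoc]
            _ = _ := by rw [hzc (star w)]; simp only [mul_assoc]
      _ = (w * z) * star w * y i * w := by rw [h1]; simp only [mul_assoc]
      _ = z * (w * star w) * y i * w := by rw [← hzc w]; simp only [mul_assoc]
      _ = z * (y i * w) := by rw [hww, mul_one, mul_assoc]
      _ = _ := hzc _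
  set U := u * (1 - z) + w * z with hU
  have hz0 : z * (1 - z) = 0 := by rw [mul_sub, mul_one, hzz, sub_self]
  have hz0' : (1 - z) * z = 0 := by rw [sub_mul, one_mul, hzz, sub_self]
  have hz1 : (1 - z) * (1 - z) = 1 - z := hz.one_sub.isIdempotentElem
  have hUs : star U = star u * (1 - z) + star w * z := by
    rw [hU, star_add, star_mul, star_mul, star_sub, star_one, hzs, hzc (star w)]
    rw [sub_mul, mul_sub, hzc (star u), one_mul, mul_one]
  have hmul : ∀ b b' c c' : M, b * b' = 1 → c * c' = 1 →
      (b * (1 - z) + c * z) * (b' * (1 - z) + c' * z) = 1 := by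
    intro b b' c c' hb hc
    have h1 := hzc b'
    have h2 := hzc c'
    linear_combination (norm := noncomm_ring) -b * h1 * (1 - z) + hb * ((1 - z) * (1 - z)) + hz1
      - b * h2 * z + b * c' * hz0' + c * h1 * (1 - z) + c * b' * hz0 + c * h2 * z
      + hc * (z * z) + hzz
  have hUU : U * star U = 1 := by rw [hUs]; exact hmul _ _ _ _ huu hww
  have hUU' : star U * U = 1 := by rw [hUs]; exact hmul _ _ _ _ huu' hww'
  have hUx : U * x = y i * U := by
    have h2 := hzc x
    rw [hU]
    linear_combination (norm := noncomm_ring) hux + hwx' - u * h2 + w * h2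
  refine ⟨star U, ⟨by rwa [star_star], by rwa [star_star]⟩, ?_⟩
  rw [star_star, hUx, mul_assoc, hUU, mul_one]

/-- A C⋆-extreme point of the unit ball of a von Neumann algebra is a partial isometry. -/
theorem VonNeumannAlgebra.mul_star_mul_self_of_isCStarExtremePoint (M : VonNeumannAlgebra H)
    {x : M} (hx : IsCStarExtremePoint x) : x * star x * x = x := by
  obtain ⟨a, s, has, haa, hss, hu⟩ := exists_abs_add_I_smul_mem_unitary hx.1
  have has' : star (a : H →L[ℂ] H) = a := congrArg Subtype.val has
  have haa' : (a : H →L[ℂ] H) * a = star (x : H →L[ℂ] H) * x := congrArg Subtype.val haa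
  obtain ⟨v, hv, hva, hvc⟩ := ContinuousLinearMap.exists_polar has' haa'
  have hvM : v ∈ M := by
    refine M.mem_of_commute fun c hc => DFunLike.congr_fun (hvc c ?_ ?_)
    · exact (VonNeumannAlgebra.mem_commutant_iff.1 hc a a.2).symm
    · exact (VonNeumannAlgebra.mem_commutant_iff.1 hc x x.2).symm
  have hv' : (⟨v, hvM⟩ : M) * star ⟨v, hvM⟩ * ⟨v, hvM⟩ = ⟨v, hvM⟩ := Subtype.ext hv
  have hva' : (⟨v, hvM⟩ : M) * a = x := Subtype.ext hva
  exact hx.mul_star_mul_self has hss hu hv' hva'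

end Hilbert

/-! ### Isolated points and passage to the closure. -/

/-- The values of a C⋆-extreme point of the unit ball of `C(Ω, A)` at isolated points are
C⋆-extreme. -/
theorem IsCStarExtremePoint.apply_of_isOpen_singleton {A : Type*} [CStarAlgebra A] {Ω : Type*}
    [TopologicalSpace Ω] [CompactSpace Ω] [T2Space Ω] {f : C(Ω, A)} (hf : IsCStarExtremePoint f)
    {ω : Ω} (hω : IsOpen ({ω} : Set Ω)) : IsCStarExtremePoint (f ω) := by
  classical
  refine ⟨(f.norm_coe_le_norm ω).trans hf.1, fun k y t hy ht hsum hfsum i => ?_⟩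
  have hcl : IsClopen ({ω} : Set Ω) := ⟨isClosed_singleton, hω⟩
  -- A combination at `ω` extends to `Ω`: elsewhere take `f` for every `y i` and the scalar `√(k⁻¹)`
  -- for every `t i`, where `k ≠ 0` because `i : Fin k` exists.
  let glue : A → C(Ω, A) → C(Ω, A) := fun a g =>
    ⟨fun ω' => if ω' ∈ ({ω} : Set Ω) then a else g ω',
      continuous_const.if (by simp [hcl.frontier_eq]) g.continuous⟩
  have hglue : ∀ a g, glue a g ω = a := fun a g => if_pos rfl
  have hglue' : ∀ a g ω', ω' ≠ ω → glue a g ω' = g ω' := fun a g ω' h => if_neg h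
  have hk : (k : ℝ) ≠ 0 := by
    have := i.pos
    positivity
  have hr : ((√(k⁻¹ : ℝ) : ℝ) : ℂ) * ((√(k⁻¹ : ℝ) : ℝ) : ℂ) = (k : ℂ)⁻¹ := by
    rw [← Complex.ofReal_mul, Real.mul_self_sqrt (by positivity)]; simp
  set r : ℂ := ((√(k⁻¹ : ℝ) : ℝ) : ℂ) with hrdef
  have hkc : (k : ℂ) ≠ 0 := by exact_mod_cast hk
  have hrs : star r = r := by simp [hrdef]
  have hr0 : r ≠ 0 := fun h => by simp [h] at hr; exact hkc hr.symm
  have h1 : ∀ i, ‖glue (y i) f‖ ≤ 1 := by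
    intro i
    rw [ContinuousMap.norm_le _ zero_le_one]
    intro ω'
    by_cases h : ω' = ω
    · rw [h, hglue]; exact hy i
    · rw [hglue' _ _ _ h]; exact (f.norm_coe_le_norm ω').trans hf.1
  have h2 : ∀ i, IsUnit (glue (t i) (r • 1)) := by
    intro i
    obtain ⟨⟨a, b, hab, hba⟩, h : a = t i⟩ := ht i
    refine ⟨⟨glue (t i) (r • 1), glue b (r⁻¹ • 1), ?_, ?_⟩, rfl⟩ <;>
    · ext ω'
      by_cases h' : ω' = ω
      · subst h'; simp [hglue, ← h, hab, hba]
      · simp [hglue' _ _ _ h', hr0]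
  have h3 : ∑ i, star (glue (t i) (r • 1)) * glue (t i) (r • 1) = 1 := by
    ext ω'
    by_cases h : ω' = ω
    · subst h; simpa [hglue] using hsum
    · simp only [ContinuousMap.sum_apply, ContinuousMap.mul_apply, ContinuousMap.star_apply,
        hglue' _ _ _ h, ContinuousMap.smul_apply, ContinuousMap.one_apply, star_smul, star_one,
        hrs, smul_mul_smul_comm, hr, mul_one, Finset.sum_const, Finset.card_univ,
        Fintype.card_fin]
      rw [← Nat.cast_smul_eq_nsmul ℂ, smul_smul, mul_inv_cancel₀ hkc, one_smul]
  have h4 : f = ∑ i, star (glue (t i) (r • 1)) * glue (y i) f * glue (t i) (r • 1) := by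
    ext ω'
    by_cases h : ω' = ω
    · subst h; simpa [hglue] using hfsum
    · simp only [ContinuousMap.sum_apply, ContinuousMap.mul_apply, ContinuousMap.star_apply,
        hglue' _ _ _ h, ContinuousMap.smul_apply, ContinuousMap.one_apply, star_smul, star_one,
        hrs, smul_mul_assoc, mul_smul_comm, smul_smul, hr, mul_one, one_mul, Finset.sum_const,
        Finset.card_univ, Fintype.card_fin]
      rw [← Nat.cast_smul_eq_nsmul ℂ, smul_smul, mul_inv_cancel₀ hkc, one_smul]
  obtain ⟨u, hu, huf⟩ := hf.2 k _ _ h1 h2 h3 h4 i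
  refine ⟨u ω, ⟨DFunLike.congr_fun hu.1 ω, DFunLike.congr_fun hu.2 ω⟩, ?_⟩
  have := DFunLike.congr_fun huf ω
  rw [hglue] at this
  exact this

theorem propositionc {H : Type*} [NormedAddCommGroup H] [InnerProductSpace ℂ H] [CompleteSpace H]
    (M : VonNeumannAlgebra H)
    {Ω : Type*} [TopologicalSpace Ω] [CompactSpace Ω] [T2Space Ω]
    (hΩ : Dense {ω : Ω | IsOpen ({ω} : Set Ω)})
    (f : C(Ω, M)) (hf : IsCStarExtremePoint f) (ω : Ω) :
    IsCStarExtremePoint (f ω) := by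
  have hiso : ∀ ω ∈ {ω : Ω | IsOpen ({ω} : Set Ω)}, IsCStarExtremePoint (f ω) :=
    fun ω hω => hf.apply_of_isOpen_singleton hω
  have hpi : ∀ ω, f ω * star (f ω) * f ω = f ω :=
    isClosed_property hΩ.denseRange_val (isClosed_eq (by fun_prop) (by fun_prop))
      fun ω => M.mul_star_mul_self_of_isCStarExtremePoint (hiso ω ω.2)
  refine M.isCStarExtremePoint_of_defect_mul_defect (hpi ω) fun m => ?_
  -- With `m` constant, the defect identity is a closed condition on `ω`.
  exact isClosed_property hΩ.denseRange_val
    (p := fun ω => (1 - f ω * star (f ω)) * m * (1 - star (f ω) * f ω) = 0)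
    (isClosed_eq (by fun_prop) (by fun_prop))
    (fun ω => (hiso ω ω.2).defect_mul_defect (hpi ω) m) ω
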